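/- For integers $m\ge 0$ and $0\le j\le m$ let $\beta_{mj}(t)=(m+1)\binom mj t^j(1-t)^{m-j}$ be the density and $\mathcal B_{mj}(t)=\int_0^t\beta_{mj}(x)\,dx$ the distribution function, on $[0,1]$, of the beta$(j+1,m-j+1)$ distribution. Let $\mathbb S_m=\{(p_0,\dots,p_m): p_j\ge 0,\ \sum_j p_j=1\}$, and for $p=(p_0,\dots,p_m)\in\mathbb R^{m+1}$ let $f_m(t;p)=\sum_{j=0}^m p_j\beta_{mj}(t)$. For a partition $0=t_0<t_1<\dots<t_N=1$ put $\Delta t_i=t_i-t_{i-1}$ and $\theta_{mi}(p)=\sum_{j=0}^m p_j\{\mathcal B_{mj}(t_i)-\mathcal B_{mj}(t_{i-1})\}$. For $p^{(0)}\in\mathbb S_m$ define $$\|p\|_B^2=\int_0^1\frac{f_m(t;p)^2}{f_m(t;p^{(0)})}\,dt,\qquad \|p\|_G^2=\sum_{i=1}^N\frac{\theta_{mi}(p)^2}{\theta_{mi}(p^{(0)})}.$$ Let $k\ge1$ be an integer and let $f\in C^{(2k)}[0,1]$ be a probability density on $[0,1]$ with $f(t)\ge\delta>0$ for all $t\in[0,1]$.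 For each $m$ let $p^{(0)}\in\mathbb S_m$ be such that $f_m(\cdot;p^{(0)})$ is a best approximation of $f$ in the uniform norm on $[0,1]$ among all $f_m(\cdot;q)$, $q\in\mathbb S_m$. Then $$\|p-p^{(0)}\|_B^2=\|p-p^{(0)}\|_G^2+O\bigl(m^4\max_i\Delta t_i^2\bigr)\qquad\text{for all }p\in\mathbb S_m,$$ in the following sense. There are constants $C$ and $m_0$, independent of $m$, of the choice of $p^{(0)}$, of $p$ and of the partition, such that for every $m\ge m_0$ one has $f_m(t;p^{(0)})>0$ on $[0,1]$ and $$\bigl|\|p-p^{(0)}\|_B^2-\|p-p^{(0)}\|_G^2\bigr|\le C\,m^4\max_{1\le i\le N}\Delta t_i^2$$ for every $p\in\mathbb S_m$ and every partition. Moreover, for every single $m$ and every such $p^{(0)}$ with $f_m(t;p^{(0)})>0$ on $[0,1]$, the same inequality holds for every $p\in\mathbb S_m$ and every partition with a constant that may depend on $m$ and $p^{(0)}$ but not on $p$ or the partition. -/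

import Mathlib

open Set

namespace BernsteinModel

noncomputable section

/-- The density `β_{mj}(t) = (m+1) * choose m j * t^j * (1-t)^(m-j)` of the distribution
beta(`j+1`, `m-j+1`) on `[0,1]`. -/
def betaDensity (m j : ℕ) (t : ℝ) : ℝ :=
  ((m : ℝ) + 1) * (bernsteinPolynomial ℝ m j).eval t

/-- The cumulative distribution function of beta(`j+1`, `m-j+1`), for `t ∈ [0,1]`. -/
def betaCDF (m j : ℕ) (t : ℝ) : ℝ :=
  ∫ x in (0 : ℝ)..t, betaDensity m j x

/-- `f_m(t; p) = ∑_{j=0}^m p_{mj} β_{mj}(t)`. -/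
def mixture {m : ℕ} (p : Fin (m + 1) → ℝ) (t : ℝ) : ℝ :=
  ∑ j : Fin (m + 1), p j * betaDensity m j t

/-- The uniform distance on `[0,1]` between `f` and `f_m(·; p)`. -/
def uniformError {m : ℕ} (f : ℝ → ℝ) (p : Fin (m + 1) → ℝ) : ℝ :=
  ⨆ t : Icc (0 : ℝ) 1, |f t - mixture p t|

/-- `p` is in the simplex, and `f_m(·; p)` is a best uniform approximation of `f` on `[0,1]` among
all `f_m(·; q)` with `q` in the simplex. -/
def IsBestApprox {m : ℕ} (f : ℝ → ℝ) (p : Fin (m + 1) → ℝ) : Prop :=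
  p ∈ stdSimplex ℝ (Fin (m + 1)) ∧
    ∀ q ∈ stdSimplex ℝ (Fin (m + 1)), uniformError f p ≤ uniformError f q

/-- The class limits `0 = t_0 < t_1 < ⋯ < t_N = 1`. -/
structure IsClassPartition {N : ℕ} (t : Fin (N + 1) → ℝ) : Prop where
  strictMono : StrictMono t
  first : t 0 = 0
  last : t (Fin.last N) = 1

/-- The class width `Δt_i = t_i - t_{i-1}`; the index `i : Fin N` stands for the `(i+1)`-st class. -/
def classWidth {N : ℕ} (t : Fin (N + 1) → ℝ) (i : Fin N) : ℝ :=
  t i.succ - t i.castSucc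

/-- `θ_{mi}(p) = ∑_j p_{mj} (B_{mj}(t_i) - B_{mj}(t_{i-1}))`. -/
def classProb {m N : ℕ} (t : Fin (N + 1) → ℝ) (p : Fin (m + 1) → ℝ) (i : Fin N) : ℝ :=
  ∑ j : Fin (m + 1), p j * (betaCDF m j (t i.succ) - betaCDF m j (t i.castSucc))

/-- The squared integral norm `‖v‖_B²` with weight determined by `p₀`. -/
def normSqB {m : ℕ} (p₀ v : Fin (m + 1) → ℝ) : ℝ :=
  ∫ x in (0 : ℝ)..1, (mixture v x) ^ 2 / mixture p₀ x

/-- The squared grouped norm `‖v‖_G²` with weights determined by `p₀` and the classes. -/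
def normSqG {m N : ℕ} (t : Fin (N + 1) → ℝ) (p₀ v : Fin (m + 1) → ℝ) : ℝ :=
  ∑ i : Fin N, (classProb t v i) ^ 2 / classProb t p₀ i

end

end BernsteinModel

/-! Write `g = mixture p₀` and `h = mixture (p - p₀)`. On one class, `∫ h²/g - (∫ h)²/∫ g` is `∫ g`
times the variance of `h/g` under the probability density proportional to `g`. If `h/g` is
`K`-Lipschitz, this is nonnegative and at most `K² Δt² ∫ g`. As `∫ g = 1` over `[0,1]`, summing over
the classes bounds the difference of the squared norms by `K² max Δt²`
(`abs_normSqB_sub_normSqG_le`).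

It remains to get `K = O(m²)` from `(h/g)' = h'/g - h g'/g²`. The Bernstein coefficients of `h` are
at most `m + 1` in size, so `h = O(m)` and `h' = O(m²)`. For `g`, one needs a positive lower bound
and `g' = O(m)`. The Kantorovich approximation of `f` has weights in the simplex, error `O(1/m)` and
bounded derivative. A best approximation is therefore also within `O(1/m)` of `f`, which gives `g ≥
δ/2` for large `m`. Markov's inequality on the difference of the two approximations costs a factor
`m²`, giving `g' = O(m)`. Two derivatives of `f` suffice for every `k ≥ 1`.

For a single degree, compactness supplies both bounds on `g`. -/

namespace BernsteinModel

/-! ### Markov's inequality -/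

open Polynomial in
/-- Markov's inequality at an endpoint of `[-1,1]`. -/
theorem eval_one_derivative_le {n : ℕ} {P : ℝ[X]} {M : ℝ} (hdeg : P.degree ≤ n)
    (hM : ∀ x ∈ Icc (-1 : ℝ) 1, |P.eval x| ≤ M) : P.derivative.eval 1 ≤ M * (n : ℝ) ^ 2 := by
  -- Rescaling by `M'⁻¹` allows comparison with the Chebyshev polynomial, where `T_n'(1) = n²`.
  -- Since `M` may be `0`, it is approached from above.
  have key : ∀ M' : ℝ, 0 < M' → M ≤ M' → P.derivative.eval 1 ≤ M' * (n : ℝ) ^ 2 := by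
    intro M' hM' hle
    have h := Chebyshev.eval_iterate_derivative_le_of_forall_abs_le_one (n := n)
      (P := C M'⁻¹ * P) (k := 1) (x := 1) le_rfl
      ((degree_C_mul (inv_ne_zero hM'.ne')).trans_le hdeg) (by
        intro x hx
        rw [eval_mul, eval_C, abs_mul, abs_of_pos (inv_pos.2 hM'), inv_mul_le_one₀ hM']
        exact (hM x hx).trans hle)
    simp only [Function.iterate_one, Chebyshev.derivative_T_eval_one, derivative_C_mul, eval_mul,
      eval_C] at h
    rw [inv_mul_le_iff₀ hM'] at h
    exact_mod_cast h
  have hM0 : 0 ≤ M := (abs_nonneg _).trans (hM 0 (by norm_num))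
  refine le_of_forall_pos_le_add fun ε hε => ?_
  have := key (M + ε / ((n : ℝ) ^ 2 + 1)) (by positivity) (by
    have : 0 ≤ ε / ((n : ℝ) ^ 2 + 1) := by positivity
    linarith)
  have h2 : ε / ((n : ℝ) ^ 2 + 1) * (n : ℝ) ^ 2 ≤ ε := by
    rw [div_mul_eq_mul_div, div_le_iff₀ (by positivity)]
    nlinarith
  linarith

open Polynomial in
/-- Markov's inequality on `[0,1]`, with a non-optimal constant. -/
theorem abs_eval_derivative_le {n : ℕ} {P : ℝ[X]} {M : ℝ} (hdeg : P.degree ≤ n)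
    (hM : ∀ x ∈ Icc (0 : ℝ) 1, |P.eval x| ≤ M) {x : ℝ} (hx : x ∈ Icc (0 : ℝ) 1) :
    |P.derivative.eval x| ≤ 4 * M * (n : ℝ) ^ 2 := by
  -- The map `y ↦ a + b y` sends the endpoint `1` to `x`, so the endpoint inequality controls `b
  -- Q'(x)`.
  have affine : ∀ (Q : ℝ[X]) (a b : ℝ), Q.degree ≤ n → a + b = x →
      (∀ y ∈ Icc (-1 : ℝ) 1, a + b * y ∈ Icc (0 : ℝ) 1) →
      (∀ x ∈ Icc (0 : ℝ) 1, |Q.eval x| ≤ M) → b * Q.derivative.eval x ≤ M * (n : ℝ) ^ 2 := by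
    intro Q a b hQ hab hmem hQM
    have h := eval_one_derivative_le (n := n) (P := Q.comp (C a + C b * X)) (M := M) (by
      refine degree_le_of_natDegree_le (natDegree_comp_le.trans ?_)
      have h1 : (C a + C b * X).natDegree ≤ 1 := by
        rw [add_comm]; exact natDegree_linear_le
      calc _ ≤ Q.natDegree * 1 := by gcongr
        _ ≤ n := by simpa using natDegree_le_of_degree_le hQ) (by
      intro y hy
      simpa using hQM _ (hmem y hy))
    simpa [derivative_comp, hab] using h
  have both : ∀ (a b : ℝ), 1 / 4 ≤ |b| → a + b = x →
      (∀ y ∈ Icc (-1 : ℝ) 1, a + b * y ∈ Icc (0 : ℝ) 1) →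
      |P.derivative.eval x| ≤ 4 * M * (n : ℝ) ^ 2 := by
    intro a b hb hab hmem
    have h1 := affine P a b hdeg hab hmem hM
    have h2 := affine (-P) a b (by simpa using hdeg) hab hmem (by simpa using hM)
    simp only [derivative_neg, eval_neg] at h2
    have h3 : |b| * |P.derivative.eval x| ≤ M * (n : ℝ) ^ 2 := by
      rw [← abs_mul, abs_le]; constructor <;> linarith
    have := mul_le_mul_of_nonneg_right hb (abs_nonneg (P.derivative.eval x))
    linarith
  obtain ⟨h0, h1⟩ := hx
  -- Map `[-1,1]` onto the longer of `[0,x]` and `[x,1]`; then `|b| ≥ 1/4`, whence the factor `4`.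
  rcases le_total (1 / 2) x with h | h
  · refine both (x / 2) (x / 2) (by rw [abs_of_nonneg] <;> linarith) (by ring) fun y hy => ?_
    obtain ⟨hy0, hy1⟩ := hy
    constructor <;> nlinarith
  · refine both ((1 + x) / 2) (-((1 - x) / 2))
      (by rw [abs_neg, abs_of_nonneg] <;> linarith) (by ring) fun y hy => ?_
    obtain ⟨hy0, hy1⟩ := hy
    constructor <;> nlinarith


/-! ### Comparison of the two norms -/

open intervalIntegral

/-- Comparison of the two norms on a single class. -/
theorem integral_sq_div_sub_sq_div {g h : ℝ → ℝ} {a b K : ℝ} (hab : a < b)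
    (hg : Continuous g) (hh : Continuous h) (hpos : ∀ x ∈ Icc a b, 0 < g x)
    (hK : ∀ x ∈ Icc a b, ∀ y ∈ Icc a b, |h x / g x - h y / g y| ≤ K * |x - y|) :
    |(∫ x in a..b, h x ^ 2 / g x) - (∫ x in a..b, h x) ^ 2 / ∫ x in a..b, g x|
      ≤ K ^ 2 * (b - a) ^ 2 * ∫ x in a..b, g x := by
  have huIcc : uIcc a b = Icc a b := uIcc_of_le hab.le
  have hG : 0 < ∫ x in a..b, g x :=
    intervalIntegral_pos_of_pos_on (hg.intervalIntegrable a b)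
      (fun x hx => hpos x (Ioo_subset_Icc_self hx)) hab
  set G := ∫ x in a..b, g x
  set H := ∫ x in a..b, h x
  have hi1 : IntervalIntegrable (fun x => h x ^ 2 / g x) MeasureTheory.volume a b := by
    apply ContinuousOn.intervalIntegrable
    rw [huIcc]
    exact (hh.pow 2).continuousOn.div hg.continuousOn fun x hx => (hpos x hx).ne'
  have hid : ∀ c : ℝ, ∫ x in a..b, g x * (h x / g x - c) ^ 2
      = (∫ x in a..b, h x ^ 2 / g x) - 2 * c * H + c ^ 2 * G := by
    intro c
    have : ∫ x in a..b, g x * (h x / g x - c) ^ 2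
        = ∫ x in a..b, (h x ^ 2 / g x - 2 * c * h x + c ^ 2 * g x) := by
      refine integral_congr fun x hx => ?_
      rw [huIcc] at hx
      have := (hpos x hx).ne'
      field_simp
      ring
    rw [this, integral_add, integral_sub, integral_const_mul, integral_const_mul]
    · exact hi1
    · exact (hh.const_mul _).intervalIntegrable _ _
    · exact hi1.sub ((hh.const_mul _).intervalIntegrable _ _)
    · exact (hg.const_mul _).intervalIntegrable _ _
  -- The weighted mean `c = H / G` minimises the quadratic `hid`, with exactly this value.
  have hnonneg : 0 ≤ (∫ x in a..b, h x ^ 2 / g x) - H ^ 2 / G := by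
    have h1 : 0 ≤ ∫ x in a..b, g x * (h x / g x - H / G) ^ 2 :=
      integral_nonneg hab.le fun x hx => mul_nonneg (hpos x hx).le (sq_nonneg _)
    rw [hid] at h1
    have : H ^ 2 / G = 2 * (H / G) * H - (H / G) ^ 2 * G := by field_simp; ring
    linarith
  rw [abs_of_nonneg hnonneg]
  have ha : a ∈ Icc a b := left_mem_Icc.2 hab.le
  -- Any other centre only increases the second moment, so the value of `h/g` at `a` serves for the
  -- upper bound; the excess is the square in `h4`.
  have h2 : ∫ x in a..b, g x * (h x / g x - h a / g a) ^ 2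
      ≤ ∫ x in a..b, K ^ 2 * (b - a) ^ 2 * g x := by
    refine integral_mono_on hab.le ?_ ((hg.const_mul _).intervalIntegrable _ _) fun x hx => ?_
    · apply ContinuousOn.intervalIntegrable
      rw [huIcc]
      exact hg.continuousOn.mul (((hh.continuousOn.div hg.continuousOn
        fun x hx => (hpos x hx).ne').sub continuousOn_const).pow 2)
    · rw [mul_comm]
      refine mul_le_mul_of_nonneg_right ?_ (hpos x hx).le
      calc (h x / g x - h a / g a) ^ 2 = |h x / g x - h a / g a| ^ 2 := (sq_abs _).symm
        _ ≤ (K * |x - a|) ^ 2 := by gcongr; exact hK x hx a ha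
        _ = K ^ 2 * (x - a) ^ 2 := by rw [mul_pow, sq_abs]
        _ ≤ K ^ 2 * (b - a) ^ 2 := by
            have := hx.1
            have := hx.2
            gcongr
  rw [hid, integral_const_mul] at h2
  have h3 : H ^ 2 / G - 2 * (h a / g a) * H + (h a / g a) ^ 2 * G
      = (H - h a / g a * G) ^ 2 / G := by field_simp; ring
  have h4 : 0 ≤ (H - h a / g a * G) ^ 2 / G := by positivity
  linarith

/-- The integral over `[0,1]` is the sum of the integrals over the classes. -/
theorem IsClassPartition.sum_integral {N : ℕ} {t : Fin (N + 1) → ℝ} (ht : IsClassPartition t)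
    {φ : ℝ → ℝ} (hφ : ContinuousOn φ (Icc 0 1)) :
    ∑ i : Fin N, ∫ x in t i.castSucc..t i.succ, φ x = ∫ x in (0 : ℝ)..1, φ x := by
  have hmem : ∀ i, t i ∈ Icc (0 : ℝ) 1 := fun i =>
    ⟨ht.first ▸ ht.strictMono.monotone (Fin.zero_le i),
      ht.last ▸ ht.strictMono.monotone (Fin.le_last i)⟩
  let s : ℕ → ℝ := fun n => if h : n < N + 1 then t ⟨n, h⟩ else 0
  have hs : ∀ n (h : n < N + 1), s n = t ⟨n, h⟩ := fun n h => dif_pos h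
  have := sum_integral_adjacent_intervals (a := s) (n := N) (f := φ)
    (μ := MeasureTheory.volume) (by
      intro k hk
      rw [hs k (by omega), hs (k + 1) (by omega)]
      exact (hφ.mono (ordConnected_Icc.uIcc_subset (hmem _) (hmem _))).intervalIntegrable)
  rw [hs 0 (by omega), hs N (by omega), Finset.sum_range] at this
  have h0 : t ⟨0, by omega⟩ = 0 := ht.first
  have h1 : t ⟨N, by omega⟩ = 1 := ht.last
  rw [h0, h1] at this
  rw [← this]
  refine Finset.sum_congr rfl fun i _ => ?_
  rw [hs i (by omega), hs (i + 1) (by omega)]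
  rfl

theorem continuous_betaDensity (m j : ℕ) : Continuous (betaDensity m j) := by
  unfold betaDensity
  fun_prop

theorem continuous_mixture {m : ℕ} (p : Fin (m + 1) → ℝ) : Continuous (mixture p) := by
  have := continuous_betaDensity m
  unfold mixture
  fun_prop

theorem integral_mixture_eq_sum {m : ℕ} (p : Fin (m + 1) → ℝ) (a b : ℝ) :
    ∫ x in a..b, mixture p x = ∑ j : Fin (m + 1), p j * ∫ x in a..b, betaDensity m j x := by
  have h : ∫ x in a..b, mixture p x = ∑ j : Fin (m + 1), ∫ x in a..b, p j * betaDensity m j x :=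
    integral_finsetSum fun j _ =>
      ((continuous_betaDensity m j).const_mul (p j)).intervalIntegrable a b
  simp_rw [h, integral_const_mul]

theorem classProb_eq_integral {m N : ℕ} (t : Fin (N + 1) → ℝ) (p : Fin (m + 1) → ℝ) (i : Fin N) :
    classProb t p i = ∫ x in t i.castSucc..t i.succ, mixture p x := by
  rw [integral_mixture_eq_sum]
  refine Finset.sum_congr rfl fun j _ => ?_
  rw [betaCDF, betaCDF, integral_interval_sub_left] <;>
    exact (continuous_betaDensity m j).intervalIntegrable _ _

/-- Comparison of the two norms when the ratio of the mixtures is Lipschitz. -/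
theorem abs_normSqB_sub_normSqG_le {m N : ℕ} {t : Fin (N + 1) → ℝ} (ht : IsClassPartition t)
    {p₀ v : Fin (m + 1) → ℝ} {K : ℝ} (hpos : ∀ x ∈ Icc (0 : ℝ) 1, 0 < mixture p₀ x)
    (hint : ∫ x in (0 : ℝ)..1, mixture p₀ x = 1)
    (hK : ∀ x ∈ Icc (0 : ℝ) 1, ∀ y ∈ Icc (0 : ℝ) 1,
      |mixture v x / mixture p₀ x - mixture v y / mixture p₀ y| ≤ K * |x - y|) :
    |normSqB p₀ v - normSqG t p₀ v| ≤ K ^ 2 * ⨆ i : Fin N, classWidth t i ^ 2 := by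
  have hg := continuous_mixture p₀
  have hh := continuous_mixture v
  have hsub : ∀ i : Fin N, Icc (t i.castSucc) (t i.succ) ⊆ Icc 0 1 := fun i =>
    Icc_subset_Icc (ht.first ▸ ht.strictMono.monotone (Fin.zero_le _))
      (ht.last ▸ ht.strictMono.monotone (Fin.le_last _))
  have hlt : ∀ i : Fin N, t i.castSucc < t i.succ := fun i => ht.strictMono i.castSucc_lt_succ
  unfold normSqB normSqG
  rw [← ht.sum_integral (φ := fun x => mixture v x ^ 2 / mixture p₀ x)
    ((hh.pow 2).continuousOn.div hg.continuousOn fun x hx => (hpos x hx).ne'),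
    ← Finset.sum_sub_distrib]
  calc _ ≤ ∑ i : Fin N, |_| := Finset.abs_sum_le_sum_abs _ _
    _ ≤ ∑ i : Fin N, (K ^ 2 * ⨆ i : Fin N, classWidth t i ^ 2) *
          ∫ x in t i.castSucc..t i.succ, mixture p₀ x := by
        refine Finset.sum_le_sum fun i _ => ?_
        rw [classProb_eq_integral, classProb_eq_integral]
        refine (integral_sq_div_sub_sq_div (hlt i) hg hh (fun x hx => hpos x (hsub i hx))
          fun x hx y hy => hK x (hsub i hx) y (hsub i hy)).trans ?_
        have : 0 ≤ ∫ x in t i.castSucc..t i.succ, mixture p₀ x :=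
          integral_nonneg (hlt i).le fun x hx => (hpos x (hsub i hx)).le
        gcongr
        exact le_ciSup (f := fun i : Fin N => classWidth t i ^ 2) (finite_range _).bddAbove i
    _ = _ := by
        rw [← Finset.mul_sum, ht.sum_integral hg.continuousOn, hint, mul_one]


/-! ### Polynomials in Bernstein form -/

open Polynomial

theorem eval_bernsteinPolynomial_nonneg (n ν : ℕ) {x : ℝ} (hx : x ∈ Icc (0 : ℝ) 1) :
    0 ≤ (bernsteinPolynomial ℝ n ν).eval x := by
  have h1 : 0 ≤ 1 - x := sub_nonneg.2 hx.2
  have h0 := hx.1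
  simp only [bernsteinPolynomial, eval_mul, eval_natCast, eval_pow, eval_X, eval_sub, eval_one]
  positivity

theorem sum_eval_bernsteinPolynomial (n : ℕ) (x : ℝ) :
    ∑ ν ∈ Finset.range (n + 1), (bernsteinPolynomial ℝ n ν).eval x = 1 := by
  rw [← eval_finsetSum, bernsteinPolynomial.sum, eval_one]

theorem sum_mul_eval_bernsteinPolynomial (n : ℕ) (x : ℝ) :
    ∑ ν ∈ Finset.range (n + 1), (ν : ℝ) * (bernsteinPolynomial ℝ n ν).eval x = n * x := by
  simpa [eval_finsetSum] using congrArg (eval x) (bernsteinPolynomial.sum_smul ℝ n)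

theorem sum_sq_mul_eval_bernsteinPolynomial (n : ℕ) (x : ℝ) :
    ∑ ν ∈ Finset.range (n + 1), (n * x - ν) ^ 2 * (bernsteinPolynomial ℝ n ν).eval x
      = n * x * (1 - x) := by
  simpa [eval_finsetSum] using congrArg (eval x) (bernsteinPolynomial.variance ℝ n)

/-- A polynomial in Bernstein form with coefficients in `[-D, D]` is bounded by `D` on `[0,1]`. -/
theorem abs_sum_mul_eval_bernsteinPolynomial_le {n : ℕ} {a : ℕ → ℝ} {D : ℝ}
    (ha : ∀ j ≤ n, |a j| ≤ D) {x : ℝ} (hx : x ∈ Icc (0 : ℝ) 1) :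
    |∑ j ∈ Finset.range (n + 1), a j * (bernsteinPolynomial ℝ n j).eval x| ≤ D := by
  calc _ ≤ ∑ j ∈ Finset.range (n + 1), |a j * (bernsteinPolynomial ℝ n j).eval x| :=
        Finset.abs_sum_le_sum_abs _ _
    _ ≤ ∑ j ∈ Finset.range (n + 1), D * (bernsteinPolynomial ℝ n j).eval x := by
        refine Finset.sum_le_sum fun j hj => ?_
        have hb := eval_bernsteinPolynomial_nonneg n j hx
        rw [abs_mul, abs_of_nonneg hb]
        exact mul_le_mul_of_nonneg_right (ha j (by simpa [Nat.lt_succ_iff] using hj)) hb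
    _ = D := by rw [← Finset.mul_sum, sum_eval_bernsteinPolynomial, mul_one]

/-- The derivative of a polynomial in Bernstein form. -/
theorem derivative_sum_bernsteinPolynomial (n : ℕ) (a : ℕ → ℝ) (x : ℝ) :
    (derivative (∑ j ∈ Finset.range (n + 2), C (a j) * bernsteinPolynomial ℝ (n + 1) j)).eval x
      = (n + 1) * ∑ j ∈ Finset.range (n + 1),
          (a (j + 1) - a j) * (bernsteinPolynomial ℝ n j).eval x := by
  have hlast : (bernsteinPolynomial ℝ n (n + 1)).eval x = 0 := by
    rw [bernsteinPolynomial.eq_zero_of_lt ℝ (Nat.lt_succ_self n), eval_zero]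
  have hs : ∑ j ∈ Finset.range (n + 1), a (j + 1) * (bernsteinPolynomial ℝ n (j + 1)).eval x
      + a 0 * (bernsteinPolynomial ℝ n 0).eval x
      = ∑ j ∈ Finset.range (n + 1), a j * (bernsteinPolynomial ℝ n j).eval x := by
    rw [← Finset.sum_range_succ' fun j => a j * (bernsteinPolynomial ℝ n j).eval x,
      Finset.sum_range_succ, hlast, mul_zero, add_zero]
  rw [Finset.sum_range_succ', derivative_add, derivative_sum, eval_add, eval_finsetSum]
  simp only [derivative_C_mul, bernsteinPolynomial.derivative_succ,
    bernsteinPolynomial.derivative_zero, eval_mul, eval_C, eval_sub, eval_natCast, eval_neg,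
    Nat.add_sub_cancel, sub_mul, Finset.sum_sub_distrib, ← hs]
  rw [mul_sub, mul_add, Finset.mul_sum, Finset.mul_sum]
  simp only [mul_sub, Finset.sum_sub_distrib]
  push_cast
  have e1 : ∀ c d : ℕ → ℝ, ∑ j ∈ Finset.range (n + 1), c j * (((n : ℝ) + 1) * d j)
      = ∑ j ∈ Finset.range (n + 1), ((n : ℝ) + 1) * (c j * d j) :=
    fun c d => Finset.sum_congr rfl fun j _ => by ring
  rw [e1 (fun j => a (j + 1)), e1 (fun j => a (j + 1))]
  ring

/-- The derivative is again in Bernstein form, of degree `m - 1`, with coefficients `m (a (j + 1) -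
a j)`. -/
theorem abs_derivative_sum_bernsteinPolynomial_le {m : ℕ} {a : ℕ → ℝ} {D : ℝ}
    (ha : ∀ j < m, |a (j + 1) - a j| ≤ D) {x : ℝ} (hx : x ∈ Icc (0 : ℝ) 1) :
    |(derivative (∑ j ∈ Finset.range (m + 1), C (a j) * bernsteinPolynomial ℝ m j)).eval x|
      ≤ m * D := by
  cases m with
  | zero => simp [bernsteinPolynomial]
  | succ n =>
    rw [derivative_sum_bernsteinPolynomial, abs_mul, Nat.cast_succ,
      abs_of_nonneg (by positivity : (0 : ℝ) ≤ (n : ℝ) + 1)]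
    refine mul_le_mul_of_nonneg_left ?_ (by positivity)
    exact abs_sum_mul_eval_bernsteinPolynomial_le (a := fun j => a (j + 1) - a j)
      (fun j hj => ha j (by omega)) hx

/-! ### Mixtures as polynomials -/

/-- The polynomial whose values are those of `mixture`, with the weights indexed by `ℕ`. -/
noncomputable def bernsteinForm (m : ℕ) (a : ℕ → ℝ) : ℝ[X] :=
  ∑ j ∈ Finset.range (m + 1), C (a j) * bernsteinPolynomial ℝ m j

theorem eval_bernsteinForm (m : ℕ) (a : ℕ → ℝ) (x : ℝ) :
    (bernsteinForm m a).eval x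
      = ∑ j ∈ Finset.range (m + 1), a j * (bernsteinPolynomial ℝ m j).eval x := by
  simp [bernsteinForm, eval_finsetSum]

theorem degree_bernsteinForm_le (m : ℕ) (a : ℕ → ℝ) : (bernsteinForm m a).degree ≤ m := by
  refine (degree_sum_le _ _).trans (Finset.sup_le fun j hj => ?_)
  have hj' : j ≤ m := by simpa [Nat.lt_succ_iff] using hj
  refine degree_le_of_natDegree_le ?_
  have h1 : (1 - X : ℝ[X]).natDegree ≤ 1 := by
    simpa using natDegree_sub_le (1 : ℝ[X]) X
  have h2 : ((1 - X : ℝ[X]) ^ (m - j)).natDegree ≤ m - j := by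
    simpa using natDegree_pow_le_of_le (m - j) h1
  have h3 : ((m.choose j : ℝ[X]) * X ^ j).natDegree ≤ j := by
    rw [← C_eq_natCast]; exact natDegree_C_mul_X_pow_le _ _
  refine (natDegree_C_mul_le _ _).trans ?_
  exact (natDegree_mul_le_of_le h3 h2).trans (by omega)

/-- The coefficients of `mixture p` in the Bernstein basis, extended by zero. -/
noncomputable def bernsteinCoeff {m : ℕ} (p : Fin (m + 1) → ℝ) (j : ℕ) : ℝ :=
  if h : j < m + 1 then ((m : ℝ) + 1) * p ⟨j, h⟩ else 0

theorem bernsteinCoeff_val {m : ℕ} (p : Fin (m + 1) → ℝ) (j : Fin (m + 1)) :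
    bernsteinCoeff p j = ((m : ℝ) + 1) * p j := by
  rw [bernsteinCoeff, dif_pos j.isLt]

theorem mixture_eq_eval {m : ℕ} (p : Fin (m + 1) → ℝ) (x : ℝ) :
    mixture p x = (bernsteinForm m (bernsteinCoeff p)).eval x := by
  rw [eval_bernsteinForm, Finset.sum_range]
  refine Finset.sum_congr rfl fun j _ => ?_
  rw [bernsteinCoeff_val, betaDensity]
  ring

theorem hasDerivAt_mixture {m : ℕ} (p : Fin (m + 1) → ℝ) (x : ℝ) :
    HasDerivAt (mixture p) ((derivative (bernsteinForm m (bernsteinCoeff p))).eval x) x := by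
  rw [funext (mixture_eq_eval p)]
  exact Polynomial.hasDerivAt _ x

theorem bernsteinCoeff_mem {m : ℕ} {p : Fin (m + 1) → ℝ} (hp : p ∈ stdSimplex ℝ (Fin (m + 1)))
    (j : ℕ) : bernsteinCoeff p j ∈ Icc (0 : ℝ) (m + 1) := by
  unfold bernsteinCoeff
  split_ifs with h
  · have h1 : p ⟨j, h⟩ ≤ 1 := (mem_Icc_of_mem_stdSimplex hp _).2
    have h0 : 0 ≤ p ⟨j, h⟩ := hp.1 _
    constructor
    · positivity
    · nlinarith
  · constructor <;> positivity

theorem bernsteinCoeff_sub {m : ℕ} (p q : Fin (m + 1) → ℝ) (j : ℕ) :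
    bernsteinCoeff (p - q) j = bernsteinCoeff p j - bernsteinCoeff q j := by
  unfold bernsteinCoeff
  split_ifs <;> simp [mul_sub]

theorem abs_bernsteinCoeff_sub_le {m : ℕ} {p q : Fin (m + 1) → ℝ}
    (hp : p ∈ stdSimplex ℝ (Fin (m + 1))) (hq : q ∈ stdSimplex ℝ (Fin (m + 1))) (j : ℕ) :
    |bernsteinCoeff (p - q) j| ≤ m + 1 := by
  have h1 := bernsteinCoeff_mem hp j
  have h2 := bernsteinCoeff_mem hq j
  rw [bernsteinCoeff_sub, abs_le]
  constructor <;> linarith [h1.1, h1.2, h2.1, h2.2]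

theorem abs_mixture_sub_le {m : ℕ} {p q : Fin (m + 1) → ℝ}
    (hp : p ∈ stdSimplex ℝ (Fin (m + 1))) (hq : q ∈ stdSimplex ℝ (Fin (m + 1)))
    {x : ℝ} (hx : x ∈ Icc (0 : ℝ) 1) : |mixture (p - q) x| ≤ m + 1 := by
  rw [mixture_eq_eval, eval_bernsteinForm]
  exact abs_sum_mul_eval_bernsteinPolynomial_le
    (fun j _ => abs_bernsteinCoeff_sub_le hp hq j) hx

/-- Differencing the Bernstein coefficients gives order `m²`; Markov's inequality applied to the sup
bound would give only `m³`. -/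
theorem abs_derivative_mixture_sub_le {m : ℕ} {p q : Fin (m + 1) → ℝ}
    (hp : p ∈ stdSimplex ℝ (Fin (m + 1))) (hq : q ∈ stdSimplex ℝ (Fin (m + 1)))
    {x : ℝ} (hx : x ∈ Icc (0 : ℝ) 1) :
    |(derivative (bernsteinForm m (bernsteinCoeff (p - q)))).eval x| ≤ m * (2 * (m + 1)) := by
  refine abs_derivative_sum_bernsteinPolynomial_le (fun j _ => ?_) hx
  have h1 := abs_bernsteinCoeff_sub_le hp hq j
  have h2 := abs_bernsteinCoeff_sub_le hp hq (j + 1)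
  exact (abs_sub _ _).trans (by linarith)

/-- The derivative of the Bernstein polynomial of degree `m + 1` and index `i + 1` is `β_{m,i} -
β_{m,i+1}`. Consecutive integrals thus agree, except that `i = m` contributes the boundary value `1`
at `x = 1`; descend from `β_{m,m+1} = 0`. -/
theorem integral_betaDensity {m j : ℕ} (hj : j ≤ m) : ∫ x in (0 : ℝ)..1, betaDensity m j x = 1 := by
  have hc := continuous_betaDensity m
  have hrec : ∀ i ≤ m, ∫ x in (0 : ℝ)..1, betaDensity m i x
      = (∫ x in (0 : ℝ)..1, betaDensity m (i + 1) x) + if i = m then 1 else 0 := by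
    intro i _
    have h := intervalIntegral.integral_eq_sub_of_hasDerivAt (a := (0 : ℝ)) (b := 1)
      (f := fun x => (bernsteinPolynomial ℝ (m + 1) (i + 1)).eval x)
      (f' := fun x => betaDensity m i x - betaDensity m (i + 1) x) (fun x _ => by
        convert! Polynomial.hasDerivAt (bernsteinPolynomial ℝ (m + 1) (i + 1)) x using 1
        rw [bernsteinPolynomial.derivative_succ]
        simp only [betaDensity, Nat.add_sub_cancel, eval_mul, eval_natCast, eval_sub]
        push_cast
        ring) (((hc _).sub (hc _)).intervalIntegrable _ _)
    rw [intervalIntegral.integral_sub ((hc _).intervalIntegrable _ _)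
      ((hc _).intervalIntegrable _ _)] at h
    simp only [bernsteinPolynomial.eval_at_1, bernsteinPolynomial.eval_at_0, Nat.add_right_cancel_iff,
      Nat.succ_ne_zero, if_false, sub_zero] at h
    linarith
  induction hj using Nat.decreasingInduction with
  | self =>
    have h0 : ∀ x, betaDensity m (m + 1) x = 0 := fun x => by
      rw [betaDensity, bernsteinPolynomial.eq_zero_of_lt ℝ (Nat.lt_succ_self m), eval_zero,
        mul_zero]
    simp [hrec m le_rfl, h0]
  | of_succ i hi ih => rw [hrec i hi.le, ih, if_neg hi.ne, add_zero]

theorem integral_mixture {m : ℕ} {p : Fin (m + 1) → ℝ} (hp : p ∈ stdSimplex ℝ (Fin (m + 1))) :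
    ∫ x in (0 : ℝ)..1, mixture p x = 1 := by
  rw [integral_mixture_eq_sum]
  refine (Finset.sum_congr rfl fun j _ => ?_).trans hp.2
  rw [integral_betaDensity (by omega), mul_one]


/-! ### Lipschitz and Taylor bounds -/

theorem exists_lipschitz_bound {f : ℝ → ℝ} (hf : ContDiffOn ℝ 1 f (Icc 0 1)) :
    ∃ K : ℝ, 0 ≤ K ∧ ∀ x ∈ Icc (0 : ℝ) 1, ∀ y ∈ Icc (0 : ℝ) 1, |f y - f x| ≤ K * |y - x| := by
  obtain ⟨K, hK⟩ := isCompact_Icc.exists_bound_of_continuousOn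
    (hf.continuousOn_derivWithin (uniqueDiffOn_Icc one_pos) le_rfl)
  refine ⟨K, (norm_nonneg _).trans (hK 0 (by simp)), fun x hx y hy => ?_⟩
  exact (convex_Icc (0 : ℝ) 1).norm_image_sub_le_of_norm_hasDerivWithin_le
    (fun z hz => (hf.differentiableOn one_ne_zero z hz).hasDerivWithinAt) hK hx hy

/-- A first-order Taylor bound for `C²` functions on `[0,1]`. -/
theorem exists_taylor_bound {f : ℝ → ℝ} (hf : ContDiffOn ℝ 2 f (Icc 0 1)) :
    ∃ (L : ℝ) (f' : ℝ → ℝ), 0 ≤ L ∧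
      (∀ x ∈ Icc (0 : ℝ) 1, ∀ y ∈ Icc (0 : ℝ) 1, |f y - f x| ≤ L * |y - x|) ∧
      ∀ x ∈ Icc (0 : ℝ) 1, ∀ y ∈ Icc (0 : ℝ) 1,
        |f y - f x - f' x * (y - x)| ≤ L * (y - x) ^ 2 := by
  have hu : UniqueDiffOn ℝ (Icc (0 : ℝ) 1) := uniqueDiffOn_Icc one_pos
  obtain ⟨K₁, hK0, hK₁⟩ := exists_lipschitz_bound (hf.of_le one_le_two)
  obtain ⟨K₂, -, hK₂⟩ := exists_lipschitz_bound (hf.derivWithin hu (m := 1) (by norm_num))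
  have h1 : K₁ ≤ max K₁ K₂ := le_max_left _ _
  have h2 : K₂ ≤ max K₁ K₂ := le_max_right _ _
  refine ⟨max K₁ K₂, derivWithin f (Icc 0 1), hK0.trans h1, fun x hx y hy => ?_,
    fun x hx y hy => ?_⟩
  · exact (hK₁ x hx y hy).trans (by gcongr)
  · have hsub : uIcc x y ⊆ Icc 0 1 := ordConnected_Icc.uIcc_subset hx hy
    have hderiv : ∀ z ∈ uIcc x y, HasDerivWithinAt
        (fun z => f z - derivWithin f (Icc 0 1) x * z)
        (derivWithin f (Icc 0 1) z - derivWithin f (Icc 0 1) x) (uIcc x y) z := by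
      intro z hz
      have hd := ((hf.differentiableOn two_ne_zero z (hsub hz)).hasDerivWithinAt).mono hsub
      convert! hd.sub ((hasDerivWithinAt_id z _).const_mul (derivWithin f (Icc 0 1) x)) using 1
      rw [mul_one]
    have := (convex_uIcc x y).norm_image_sub_le_of_norm_hasDerivWithin_le hderiv
      (C := max K₁ K₂ * |y - x|) (fun z hz => by
        refine (hK₂ x hx z (hsub hz)).trans (mul_le_mul h2 ?_ (abs_nonneg _) (hK0.trans h1))
        exact abs_sub_left_of_mem_uIcc hz) left_mem_uIcc right_mem_uIcc
    rw [Real.norm_eq_abs, Real.norm_eq_abs, mul_assoc, abs_mul_abs_self] at this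
    convert this using 1
    · congr 1; ring
    · ring

/-! ### Bernstein and Kantorovich approximation -/

/-- The weights `∫ f` over `[j/(m+1), (j+1)/(m+1)]` of the Kantorovich operator. -/
noncomputable def kantorovichWeight (f : ℝ → ℝ) (m : ℕ) (j : ℕ) : ℝ :=
  ∫ x in ((j : ℝ) / (m + 1))..(((j + 1 : ℕ) : ℝ) / (m + 1)), f x

theorem node_mem {m j : ℕ} (hj : j ≤ m + 1) : (j : ℝ) / (m + 1) ∈ Icc (0 : ℝ) 1 := by
  have : (j : ℝ) ≤ m + 1 := by exact_mod_cast hj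
  exact ⟨by positivity, by rw [div_le_one (by positivity)]; exact this⟩

theorem kantorovichWeight_intervalIntegrable {f : ℝ → ℝ} (hf : ContinuousOn f (Icc 0 1))
    {m j : ℕ} (hj : j ≤ m) : IntervalIntegrable f MeasureTheory.volume
      ((j : ℝ) / (m + 1)) (((j + 1 : ℕ) : ℝ) / (m + 1)) :=
  (hf.mono (ordConnected_Icc.uIcc_subset (node_mem (by omega))
    (node_mem (by omega)))).intervalIntegrable

theorem kantorovichWeight_mem_stdSimplex {f : ℝ → ℝ} (hf : ContinuousOn f (Icc 0 1))
    (hf0 : ∀ x ∈ Icc (0 : ℝ) 1, 0 ≤ f x) (hint : ∫ x in (0 : ℝ)..1, f x = 1) (m : ℕ) :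
    (fun j : Fin (m + 1) => kantorovichWeight f m j) ∈ stdSimplex ℝ (Fin (m + 1)) := by
  constructor
  · intro j
    have hm : (0 : ℝ) ≤ m + 1 := by positivity
    refine intervalIntegral.integral_nonneg (by gcongr; omega) fun x hx => hf0 x ?_
    exact ⟨(node_mem (m := m) (j := j) (by omega)).1.trans hx.1,
      hx.2.trans (node_mem (by omega)).2⟩
  · have := intervalIntegral.sum_integral_adjacent_intervals (f := f)
      (a := fun j : ℕ => (j : ℝ) / ((m : ℝ) + 1)) (n := m + 1) (μ := MeasureTheory.volume)
      fun j hj => kantorovichWeight_intervalIntegrable hf (by omega)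
    rw [Finset.sum_range] at this
    have h1 : ((m + 1 : ℕ) : ℝ) / ((m : ℝ) + 1) = 1 := by
      push_cast; exact div_self (by positivity)
    rw [h1, Nat.cast_zero, zero_div, hint] at this
    exact this

theorem abs_kantorovichWeight_sub_le {f : ℝ → ℝ} {L : ℝ} (hf : ContinuousOn f (Icc 0 1))
    (hL0 : 0 ≤ L) (hL : ∀ x ∈ Icc (0 : ℝ) 1, ∀ y ∈ Icc (0 : ℝ) 1, |f y - f x| ≤ L * |y - x|)
    {m j : ℕ} (hj : j ≤ m) {y : ℝ}
    (hy : y ∈ Icc ((j : ℝ) / (m + 1)) (((j + 1 : ℕ) : ℝ) / (m + 1))) :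
    |((m : ℝ) + 1) * kantorovichWeight f m j - f y| ≤ L / (m + 1) := by
  have hm : (0 : ℝ) < m + 1 := by positivity
  have hsub : Icc ((j : ℝ) / (m + 1)) (((j + 1 : ℕ) : ℝ) / (m + 1)) ⊆ Icc 0 1 :=
    Icc_subset_Icc (node_mem (by omega)).1 (node_mem (by omega)).2
  have hlen : ((j + 1 : ℕ) : ℝ) / ((m : ℝ) + 1) - j / (m + 1) = 1 / (m + 1) := by
    push_cast; ring
  have hle : (j : ℝ) / ((m : ℝ) + 1) ≤ ((j + 1 : ℕ) : ℝ) / (m + 1) := by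
    have : (0 : ℝ) < 1 / (m + 1) := by positivity
    linarith
  have h1 : kantorovichWeight f m j - 1 / (m + 1) * f y
      = ∫ x in ((j : ℝ) / (m + 1))..(((j + 1 : ℕ) : ℝ) / (m + 1)), (f x - f y) := by
    rw [intervalIntegral.integral_sub (kantorovichWeight_intervalIntegrable hf hj) (by simp),
      intervalIntegral.integral_const, hlen, smul_eq_mul, kantorovichWeight]
  have h2 : |kantorovichWeight f m j - 1 / (m + 1) * f y| ≤ L / (m + 1) * (1 / (m + 1)) := by
    rw [h1, ← Real.norm_eq_abs]
    refine (intervalIntegral.norm_integral_le_of_norm_le_const (C := L / (m + 1))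
      fun x hx => ?_).trans_eq ?_
    · rw [uIoc_of_le hle] at hx
      have hx' := Ioc_subset_Icc_self hx
      rw [Real.norm_eq_abs]
      refine (hL y (hsub hy) x (hsub hx')).trans ?_
      rw [div_eq_mul_one_div L]
      refine mul_le_mul_of_nonneg_left ?_ hL0
      rw [abs_le]
      constructor <;> linarith [hx'.1, hx'.2, hy.1, hy.2]
    · rw [hlen, abs_of_nonneg (by positivity)]
  have h3 : ((m : ℝ) + 1) * kantorovichWeight f m j - f y
      = (m + 1) * (kantorovichWeight f m j - 1 / (m + 1) * f y) := by field_simp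
  rw [h3, abs_mul, abs_of_pos hm]
  calc _ ≤ ((m : ℝ) + 1) * (L / (m + 1) * (1 / (m + 1))) := by gcongr
    _ = L / (m + 1) := by field_simp

/-- Rate of approximation of a `C²` function by its Bernstein polynomials. -/
theorem abs_bernstein_sub_le {f f' : ℝ → ℝ} {L : ℝ} (hL0 : 0 ≤ L)
    (hT : ∀ x ∈ Icc (0 : ℝ) 1, ∀ y ∈ Icc (0 : ℝ) 1,
      |f y - f x - f' x * (y - x)| ≤ L * (y - x) ^ 2)
    {m : ℕ} (hm : m ≠ 0) {x : ℝ} (hx : x ∈ Icc (0 : ℝ) 1) :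
    |(∑ j ∈ Finset.range (m + 1), f ((j : ℝ) / m) * (bernsteinPolynomial ℝ m j).eval x) - f x|
      ≤ L / m := by
  have hm' : (0 : ℝ) < m := by positivity
  have h1 := sum_eval_bernsteinPolynomial m x
  have h2 := sum_mul_eval_bernsteinPolynomial m x
  have h3 := sum_sq_mul_eval_bernsteinPolynomial m x
  -- The linear Taylor term may be subtracted because the Bernstein weights have mean `x`; the
  -- quadratic remainder then meets their variance `x (1 - x) / m`.
  have e : (∑ j ∈ Finset.range (m + 1), f ((j : ℝ) / m) * (bernsteinPolynomial ℝ m j).eval x) - f x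
      = ∑ j ∈ Finset.range (m + 1), (f ((j : ℝ) / m) - f x - f' x * ((j : ℝ) / m - x)) *
          (bernsteinPolynomial ℝ m j).eval x := by
    have : ∀ j : ℕ, (f ((j : ℝ) / m) - f x - f' x * ((j : ℝ) / m - x)) *
        (bernsteinPolynomial ℝ m j).eval x
        = f ((j : ℝ) / m) * (bernsteinPolynomial ℝ m j).eval x
          - (f x - f' x * x) * (bernsteinPolynomial ℝ m j).eval x
          - f' x / m * ((j : ℝ) * (bernsteinPolynomial ℝ m j).eval x) := fun j => by ring
    simp_rw [this, Finset.sum_sub_distrib, ← Finset.mul_sum, h1, h2]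
    field_simp
    ring
  rw [e]
  calc _ ≤ ∑ j ∈ Finset.range (m + 1), |_| := Finset.abs_sum_le_sum_abs _ _
    _ ≤ ∑ j ∈ Finset.range (m + 1),
          L / m ^ 2 * ((m * x - j) ^ 2 * (bernsteinPolynomial ℝ m j).eval x) := by
        refine Finset.sum_le_sum fun j hj => ?_
        have hb := eval_bernsteinPolynomial_nonneg m j hx
        have hj' : (j : ℝ) ≤ m := by
          exact_mod_cast Nat.lt_succ_iff.1 (Finset.mem_range.1 hj)
        rw [abs_mul, abs_of_nonneg hb, ← mul_assoc]
        refine mul_le_mul_of_nonneg_right ((hT x hx _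
          ⟨by positivity, (div_le_one hm').2 hj'⟩).trans_eq ?_) hb
        field_simp
        ring
    _ = L / m * (x * (1 - x)) := by
        rw [← Finset.mul_sum, h3]; field_simp
    _ ≤ L / m := by
        refine mul_le_of_le_one_right (by positivity) ?_
        nlinarith [hx.1, hx.2, sq_nonneg x]

theorem bernsteinCoeff_kantorovichWeight (f : ℝ → ℝ) {m j : ℕ} (hj : j ≤ m) :
    bernsteinCoeff (fun j : Fin (m + 1) => kantorovichWeight f m j) j
      = ((m : ℝ) + 1) * kantorovichWeight f m j := by
  rw [bernsteinCoeff, dif_pos (by omega)]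

/-- Rate of approximation of a `C²` function by the Kantorovich operator. -/
theorem abs_mixture_kantorovichWeight_sub_le {f f' : ℝ → ℝ} {L : ℝ}
    (hf : ContinuousOn f (Icc 0 1)) (hL0 : 0 ≤ L)
    (hL : ∀ x ∈ Icc (0 : ℝ) 1, ∀ y ∈ Icc (0 : ℝ) 1, |f y - f x| ≤ L * |y - x|)
    (hT : ∀ x ∈ Icc (0 : ℝ) 1, ∀ y ∈ Icc (0 : ℝ) 1,
      |f y - f x - f' x * (y - x)| ≤ L * (y - x) ^ 2)
    {m : ℕ} (hm : m ≠ 0) {x : ℝ} (hx : x ∈ Icc (0 : ℝ) 1) :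
    |mixture (fun j : Fin (m + 1) => kantorovichWeight f m j) x - f x| ≤ 2 * L / m := by
  have hm' : (0 : ℝ) < m := by positivity
  have h1 := abs_bernstein_sub_le hL0 hT hm hx
  have h2 : |∑ j ∈ Finset.range (m + 1),
      (bernsteinCoeff (fun j : Fin (m + 1) => kantorovichWeight f m j) j - f ((j : ℝ) / m)) *
        (bernsteinPolynomial ℝ m j).eval x| ≤ L / m := by
    refine abs_sum_mul_eval_bernsteinPolynomial_le
      (a := fun j => bernsteinCoeff (fun j : Fin (m + 1) => kantorovichWeight f m j) j
        - f ((j : ℝ) / m)) (fun j hj => ?_) hx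
    have hj' : (j : ℝ) ≤ m := by exact_mod_cast hj
    simp only [bernsteinCoeff_kantorovichWeight f hj]
    -- The Bernstein node `j/m` lies in the cell `[j/(m+1), (j+1)/(m+1)]`.
    refine (abs_kantorovichWeight_sub_le hf hL0 hL hj ⟨?_, ?_⟩).trans ?_
    · gcongr; linarith
    · rw [div_le_div_iff₀ hm' (by positivity)]; push_cast; nlinarith
    · gcongr; linarith
  simp only [sub_mul, Finset.sum_sub_distrib] at h2
  rw [← eval_bernsteinForm, ← mixture_eq_eval] at h2
  rw [abs_le] at h1 h2 ⊢
  have : 2 * L / (m : ℝ) = L / m + L / m := by ring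
  constructor <;> linarith [h1.1, h1.2, h2.1, h2.2]

/-- The derivatives of the Kantorovich approximations are uniformly bounded. -/
theorem abs_derivative_kantorovich_le {f : ℝ → ℝ} {L : ℝ}
    (hf : ContinuousOn f (Icc 0 1)) (hL0 : 0 ≤ L)
    (hL : ∀ x ∈ Icc (0 : ℝ) 1, ∀ y ∈ Icc (0 : ℝ) 1, |f y - f x| ≤ L * |y - x|)
    (m : ℕ) {x : ℝ} (hx : x ∈ Icc (0 : ℝ) 1) :
    |(Polynomial.derivative (bernsteinForm m
      (bernsteinCoeff fun j : Fin (m + 1) => kantorovichWeight f m j))).eval x| ≤ 2 * L := by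
  refine (abs_derivative_sum_bernsteinPolynomial_le (D := 2 * L / (m + 1))
    (fun j hj => ?_) hx).trans ?_
  · rw [bernsteinCoeff_kantorovichWeight f hj, bernsteinCoeff_kantorovichWeight f hj.le]
    have hm : (0 : ℝ) ≤ m + 1 := by positivity
    -- Adjacent cells share the node `(j+1)/(m+1)`, so both coefficients are compared with `f`
    -- there.
    have h1 := abs_kantorovichWeight_sub_le hf hL0 hL (j := j) hj.le
      (y := ((j + 1 : ℕ) : ℝ) / (m + 1)) ⟨by gcongr; omega, le_rfl⟩
    have h2 := abs_kantorovichWeight_sub_le hf hL0 hL (j := j + 1) hj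
      (y := ((j + 1 : ℕ) : ℝ) / (m + 1)) ⟨le_rfl, by gcongr; omega⟩
    rw [abs_le] at h1 h2 ⊢
    have : 2 * L / ((m : ℝ) + 1) = L / (m + 1) + L / (m + 1) := by ring
    constructor <;> linarith [h1.1, h1.2, h2.1, h2.2]
  · rw [mul_div_assoc', div_le_iff₀ (by positivity)]
    nlinarith

/-! ### Best approximations and the ratio of mixtures -/

theorem bddAbove_uniformError {f : ℝ → ℝ} (hf : ContinuousOn f (Icc 0 1)) {m : ℕ}
    (p : Fin (m + 1) → ℝ) :
    BddAbove (range fun t : Icc (0 : ℝ) 1 => |f t - mixture p t|) := by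
  have h := (isCompact_Icc.image_of_continuousOn
    ((hf.sub (continuous_mixture p).continuousOn).abs)).bddAbove
  rwa [image_eq_range] at h

/-- A best approximation of a `C²` density is within `O(1/m)` of it. -/
theorem IsBestApprox.abs_sub_le {f f' : ℝ → ℝ} {L : ℝ}
    (hf : ContinuousOn f (Icc 0 1)) (hf0 : ∀ x ∈ Icc (0 : ℝ) 1, 0 ≤ f x)
    (hint : ∫ x in (0 : ℝ)..1, f x = 1) (hL0 : 0 ≤ L)
    (hL : ∀ x ∈ Icc (0 : ℝ) 1, ∀ y ∈ Icc (0 : ℝ) 1, |f y - f x| ≤ L * |y - x|)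
    (hT : ∀ x ∈ Icc (0 : ℝ) 1, ∀ y ∈ Icc (0 : ℝ) 1,
      |f y - f x - f' x * (y - x)| ≤ L * (y - x) ^ 2)
    {m : ℕ} (hm : m ≠ 0) {p : Fin (m + 1) → ℝ} (hp : IsBestApprox f p)
    {x : ℝ} (hx : x ∈ Icc (0 : ℝ) 1) : |f x - mixture p x| ≤ 2 * L / m := by
  have h1 : |f x - mixture p x| ≤ uniformError f p :=
    le_ciSup (bddAbove_uniformError hf p) ⟨x, hx⟩
  have h2 := hp.2 _ (kantorovichWeight_mem_stdSimplex hf hf0 hint m)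
  have : Nonempty (Icc (0 : ℝ) 1) := ⟨⟨x, hx⟩⟩
  refine (h1.trans h2).trans (ciSup_le fun y => ?_)
  rw [abs_sub_comm]
  exact abs_mixture_kantorovichWeight_sub_le hf hL0 hL hT hm y.2

/-- The derivative of a best approximation of a `C²` density grows at most linearly in `m`. -/
theorem IsBestApprox.abs_derivative_le {f f' : ℝ → ℝ} {L : ℝ}
    (hf : ContinuousOn f (Icc 0 1)) (hf0 : ∀ x ∈ Icc (0 : ℝ) 1, 0 ≤ f x)
    (hint : ∫ x in (0 : ℝ)..1, f x = 1) (hL0 : 0 ≤ L)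
    (hL : ∀ x ∈ Icc (0 : ℝ) 1, ∀ y ∈ Icc (0 : ℝ) 1, |f y - f x| ≤ L * |y - x|)
    (hT : ∀ x ∈ Icc (0 : ℝ) 1, ∀ y ∈ Icc (0 : ℝ) 1,
      |f y - f x - f' x * (y - x)| ≤ L * (y - x) ^ 2)
    {m : ℕ} (hm : m ≠ 0) {p : Fin (m + 1) → ℝ} (hp : IsBestApprox f p)
    {x : ℝ} (hx : x ∈ Icc (0 : ℝ) 1) :
    |(Polynomial.derivative (bernsteinForm m (bernsteinCoeff p))).eval x| ≤ 18 * L * m := by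
  have hm1 : (1 : ℝ) ≤ m := by exact_mod_cast Nat.one_le_iff_ne_zero.2 hm
  set q : Fin (m + 1) → ℝ := fun j => kantorovichWeight f m j
  have h1 := abs_eval_derivative_le (n := m) (M := 4 * L / m)
    (P := bernsteinForm m (bernsteinCoeff p) - bernsteinForm m (bernsteinCoeff q))
    ((Polynomial.degree_sub_le _ _).trans
      (max_le (degree_bernsteinForm_le _ _) (degree_bernsteinForm_le _ _)))
    (fun y hy => by
      have e1 := hp.abs_sub_le hf hf0 hint hL0 hL hT hm hy
      have e2 := abs_mixture_kantorovichWeight_sub_le hf hL0 hL hT hm hy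
      rw [Polynomial.eval_sub, ← mixture_eq_eval, ← mixture_eq_eval]
      rw [abs_le] at e1 e2 ⊢
      have : 4 * L / (m : ℝ) = 2 * L / m + 2 * L / m := by ring
      constructor <;> linarith [e1.1, e1.2, e2.1, e2.2]) hx
  have h2 := abs_derivative_kantorovich_le hf hL0 hL m hx
  have h3 : 4 * (4 * L / m) * (m : ℝ) ^ 2 = 16 * L * m := by field_simp; ring
  rw [h3, Polynomial.derivative_sub, Polynomial.eval_sub] at h1
  have h4 : L * 1 ≤ L * m := by gcongr
  rw [abs_le] at h1 h2 ⊢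
  constructor <;> linarith [h1.1, h1.2, h2.1, h2.2]

/-- The ratio of mixtures is Lipschitz, given bounds for the denominator. -/
theorem abs_mixture_div_sub_le {m : ℕ} {p p₀ : Fin (m + 1) → ℝ}
    (hp : p ∈ stdSimplex ℝ (Fin (m + 1))) (hp₀ : p₀ ∈ stdSimplex ℝ (Fin (m + 1)))
    {c G : ℝ} (hc : 0 < c) (hpos : ∀ x ∈ Icc (0 : ℝ) 1, c ≤ mixture p₀ x)
    (hG : ∀ x ∈ Icc (0 : ℝ) 1,
      |(Polynomial.derivative (bernsteinForm m (bernsteinCoeff p₀))).eval x| ≤ G)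
    {x y : ℝ} (hx : x ∈ Icc (0 : ℝ) 1) (hy : y ∈ Icc (0 : ℝ) 1) :
    |mixture (p - p₀) x / mixture p₀ x - mixture (p - p₀) y / mixture p₀ y|
      ≤ (m * (2 * (m + 1)) / c + (m + 1) * G / c ^ 2) * |x - y| := by
  have h := (convex_Icc (0 : ℝ) 1).norm_image_sub_le_of_norm_hasDerivWithin_le
    (f := fun z => mixture (p - p₀) z / mixture p₀ z) (x := y) (y := x)
    (C := m * (2 * (m + 1)) / c + (m + 1) * G / c ^ 2)
    (fun z hz => ((hasDerivAt_mixture (p - p₀) z).div (hasDerivAt_mixture p₀ z)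
      (hc.trans_le (hpos z hz)).ne').hasDerivWithinAt) (fun z hz => ?_) hy hx
  · simpa [Real.norm_eq_abs] using h
  · have e1 := abs_mixture_sub_le hp hp₀ hz
    have e2 := abs_derivative_mixture_sub_le hp hp₀ hz
    have e3 := hG z hz
    have e4 := hpos z hz
    have hg : 0 < mixture p₀ z := hc.trans_le e4
    have hsplit : ∀ h' h g' g : ℝ, 0 < g → (h' * g - h * g') / g ^ 2 = h' / g - h * g' / g ^ 2 := by
      intro h' h g' g hg
      field_simp
    rw [hsplit _ _ _ _ hg, Real.norm_eq_abs]
    refine (abs_sub _ _).trans (add_le_add ?_ ?_)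
    · rw [abs_div, abs_of_pos hg]
      gcongr
    · rw [abs_div, abs_mul, abs_of_pos (pow_pos hg 2)]
      have hG0 : 0 ≤ G := (abs_nonneg _).trans e3
      gcongr

end BernsteinModel

/-! ### The main theorem -/

theorem theorem6 (k : ℕ) (hk : 1 ≤ k) (f : ℝ → ℝ) (δ : ℝ) (hδ : 0 < δ)
    (hf : ContDiffOn ℝ ((2 * k : ℕ) : WithTop ℕ∞) f (Set.Icc 0 1))
    (hf_int : ∫ x in (0 : ℝ)..1, f x = 1)
    (hf_pos : ∀ x ∈ Set.Icc (0 : ℝ) 1, δ ≤ f x) :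
    -- uniformly in `m`, in the classes and in `p`, for all large degrees
    (∃ (C : ℝ) (m₀ : ℕ), ∀ m : ℕ, m₀ ≤ m →
      ∀ p₀ : Fin (m + 1) → ℝ, BernsteinModel.IsBestApprox f p₀ →
        (∀ x ∈ Set.Icc (0 : ℝ) 1, 0 < BernsteinModel.mixture p₀ x) ∧
        ∀ (N : ℕ) (t : Fin (N + 1) → ℝ), BernsteinModel.IsClassPartition t →
          ∀ p ∈ stdSimplex ℝ (Fin (m + 1)),
            |BernsteinModel.normSqB p₀ (p - p₀) - BernsteinModel.normSqG t p₀ (p - p₀)|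
              ≤ C * ((m : ℝ) ^ 4 * ⨆ i : Fin N, (BernsteinModel.classWidth t i) ^ 2)) ∧
    -- for each single degree for which the weight `1 / f_m(·; p₀)` has no singularity
    (∀ (m : ℕ) (p₀ : Fin (m + 1) → ℝ), BernsteinModel.IsBestApprox f p₀ →
      (∀ x ∈ Set.Icc (0 : ℝ) 1, 0 < BernsteinModel.mixture p₀ x) →
      ∃ C : ℝ, ∀ (N : ℕ) (t : Fin (N + 1) → ℝ), BernsteinModel.IsClassPartition t →
        ∀ p ∈ stdSimplex ℝ (Fin (m + 1)),
          |BernsteinModel.normSqB p₀ (p - p₀) - BernsteinModel.normSqG t p₀ (p - p₀)|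
            ≤ C * ((m : ℝ) ^ 4 * ⨆ i : Fin N, (BernsteinModel.classWidth t i) ^ 2)) := by
  open BernsteinModel in
  have hf2 : ContDiffOn ℝ 2 f (Icc 0 1) := hf.of_le (by
    have : 2 ≤ 2 * k := by omega
    exact_mod_cast this)
  have hfc := hf2.continuousOn
  have hf0 : ∀ x ∈ Icc (0 : ℝ) 1, 0 ≤ f x := fun x hx => hδ.le.trans (hf_pos x hx)
  constructor
  · obtain ⟨L, f', hL0, hL, hT⟩ := exists_taylor_bound hf2
    -- Makes the approximation error `2L/m` at most `δ/2`.
    obtain ⟨m₀, hm₀⟩ := exists_nat_ge (4 * L / δ)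
    refine ⟨(8 / δ + 144 * L / δ ^ 2) ^ 2, m₀ + 1, fun m hm p₀ hp₀ => ?_⟩
    have hm0 : m ≠ 0 := by omega
    have hm1 : (1 : ℝ) ≤ m := by exact_mod_cast Nat.one_le_iff_ne_zero.2 hm0
    have hge : ∀ x ∈ Icc (0 : ℝ) 1, δ / 2 ≤ mixture p₀ x := by
      intro x hx
      have h1 := (abs_le.1 (hp₀.abs_sub_le hfc hf0 hf_int hL0 hL hT hm0 hx)).2
      have h2 : 2 * L / m ≤ δ / 2 := by
        have : (m₀ : ℝ) ≤ m := by exact_mod_cast (Nat.le_succ m₀).trans hm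
        have := (div_le_iff₀ hδ).1 (hm₀.trans this)
        rw [div_le_iff₀ (by positivity)]
        linarith
      linarith [hf_pos x hx]
    have hpos : ∀ x ∈ Icc (0 : ℝ) 1, 0 < mixture p₀ x :=
      fun x hx => (half_pos hδ).trans_le (hge x hx)
    refine ⟨hpos, fun N t ht p hp => ?_⟩
    refine (abs_normSqB_sub_normSqG_le (K := (8 / δ + 144 * L / δ ^ 2) * m ^ 2) ht hpos
      (integral_mixture hp₀.1) fun x hx y hy => ?_).trans_eq (by ring)
    refine (abs_mixture_div_sub_le hp hp₀.1 (half_pos hδ) hge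
      (fun z hz => hp₀.abs_derivative_le hfc hf0 hf_int hL0 hL hT hm0 hz) hx hy).trans ?_
    refine mul_le_mul_of_nonneg_right ?_ (abs_nonneg _)
    have hm2 : (m : ℝ) + 1 ≤ 2 * m := by linarith
    calc (m : ℝ) * (2 * (m + 1)) / (δ / 2) + (m + 1) * (18 * L * m) / (δ / 2) ^ 2
        ≤ (m : ℝ) * (2 * (2 * m)) / (δ / 2) + (2 * m) * (18 * L * m) / (δ / 2) ^ 2 := by gcongr
      _ = (8 / δ + 144 * L / δ ^ 2) * m ^ 2 := by field_simp; ring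
  · intro m p₀ hp₀ hpos
    obtain ⟨x₀, hx₀, hmin⟩ := isCompact_Icc.exists_isMinOn
      (nonempty_Icc.2 (zero_le_one' ℝ)) (continuous_mixture p₀).continuousOn
    obtain ⟨G, hG⟩ := isCompact_Icc.exists_bound_of_continuousOn (s := Icc (0 : ℝ) 1)
      (Polynomial.derivative (bernsteinForm m (bernsteinCoeff p₀))).continuous.continuousOn
    have hc := hpos x₀ hx₀
    refine ⟨(m * (2 * (m + 1)) / mixture p₀ x₀ + (m + 1) * G / mixture p₀ x₀ ^ 2) ^ 2,
      fun N t ht p hp => ?_⟩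
    -- For `m = 0` the right side vanishes because of `m⁴`, but the simplex is a single point, so `p
    -- = p₀`.
    rcases Nat.eq_zero_or_pos m with rfl | hm
    · have hpp : p - p₀ = 0 := by
        have h1 := hp.2
        have h2 := hp₀.1.2
        rw [Fin.sum_univ_one] at h1 h2
        ext j
        rw [Subsingleton.elim (α := Fin 1) j 0, Pi.sub_apply, h1, h2, sub_self, Pi.zero_apply]
      rw [hpp]
      simp [normSqB, normSqG, mixture, classProb]
    · refine (abs_normSqB_sub_normSqG_le ht hpos (integral_mixture hp₀.1) fun x hx y hy =>
        abs_mixture_div_sub_le hp hp₀.1 hc (fun z hz => hmin hz) hG hx hy).trans ?_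
      have hm1 : (1 : ℝ) ≤ (m : ℝ) ^ 4 := one_le_pow₀ (by exact_mod_cast hm)
      have hs : 0 ≤ ⨆ i : Fin N, classWidth t i ^ 2 := Real.iSup_nonneg fun i => sq_nonneg _
      refine mul_le_mul_of_nonneg_left ?_ (sq_nonneg _)
      exact le_mul_of_one_le_left hs hm1
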